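/- Let $\mathsf A$ be an Ab5-category, that is, a cocomplete abelian category with exact direct limits, in which the groups $\operatorname{Ext}^i_{\mathsf A}(X,Y)$ are sets. Let $n\ge 0$ be an integer and let $T\in\mathsf A$ be an $n$-tilting object, that is: (i) the projective dimension of $T$ does not exceed $n$, i.e. $\operatorname{Ext}^i_{\mathsf A}(T,X)=0$ for all $i>n$ and all $X\in\mathsf A$; (ii) $\operatorname{Ext}^i_{\mathsf A}(T,T^{(I)})=0$ for all $i>0$ and all sets $I$, where $T^{(I)}$ is the coproduct of $I$ copies of $T$; (iii) every object $K$ of the unbounded derived category $\mathsf D(\mathsf A)$ with $\operatorname{Hom}_{\mathsf D(\mathsf A)}(T,K[i])=0$ for all $i\in\mathbb Z$ is zero. Let $(\mathsf L,\mathsf E)$ be the $n$-tilting cotorsion pair induced by $T$: $\mathsf E$ is the class of all $X\in\mathsf A$ with $\operatorname{Ext}^i_{\mathsf A}(T,X)=0$ for all $i>0$, and $\mathsf L$ is the class of all $X\in\mathsf A$ with $\operatorname{Ext}^1_{\mathsf A}(X,E)=0$ for all $E\in\mathsf E$. Assume that every object $X\in\mathsf A$ has an $\mathsf L$-cover, that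 is, a morphism $l\colon Y\to X$ with $Y\in\mathsf L$ such that every morphism $Y'\to X$ with $Y'\in\mathsf L$ factors through $l$, and every endomorphism $f$ of $Y$ with $lf=l$ is an automorphism. Then $\mathsf L$ is closed under direct limits in $\mathsf A$, i.e. under colimits of diagrams indexed by directed posets. -/

import Mathlib

universe w w' v u

namespace TiltingEnochs

open CategoryTheory CategoryTheory.Limits

section Covers

variable {A : Type u} [Category.{v} A]

/-- An `L`-precover of `X`: a morphism `l : Y ⟶ X` with `Y` in `L` through which every morphism
from an object of `L` to `X` factors. -/
def IsPrecover (L : ObjectProperty A) {Y X : A} (l : Y ⟶ X) : Prop :=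
  L Y ∧ ∀ ⦃Y' : A⦄ (l' : Y' ⟶ X), L Y' → ∃ f : Y' ⟶ Y, f ≫ l = l'

/-- An `L`-cover of `X`: an `L`-precover `l : Y ⟶ X` such that every endomorphism `f` of `Y`
with `f ≫ l = l` is an automorphism. -/
def IsCover (L : ObjectProperty A) {Y X : A} (l : Y ⟶ X) : Prop :=
  IsPrecover L l ∧ ∀ f : Y ⟶ Y, f ≫ l = l → IsIso f

/-- A class of objects is closed under direct limits, i.e. under colimits of diagrams
indexed by (nonempty, small) directed posets. -/
def ClosedUnderDirectLimits (L : ObjectProperty A) : Prop :=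
  ∀ (I : Type v) [PartialOrder I] [IsDirectedOrder I] [Nonempty I],
    L.IsClosedUnderColimitsOfShape I

end Covers

section Tilting

variable {A : Type u} [Category.{v} A] [Abelian A]

/-- The object `T` is `n`-tilting:
* its projective dimension does not exceed `n`;
* `Ext^i(T, T^(I)) = 0` for all `i > 0` and all sets `I`;
* every `K` in the unbounded derived category with `Hom(T, K[i]) = 0` for all integers `i`
  is zero. -/
structure IsTilting [HasCoproducts.{v} A] [HasExt.{w} A] [HasDerivedCategory.{w'} A]
    (n : ℕ) (T : A) : Prop where
  projectiveDimension_le : HasProjectiveDimensionLE T n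
  ext_coproduct : ∀ (I : Type v) (i : ℕ), 0 < i →
    Subsingleton (Abelian.Ext.{w} T (∐ fun _ : I => T) i)
  isZero_of_hom : ∀ K : DerivedCategory A,
    (∀ i : ℤ, Subsingleton ((DerivedCategory.singleFunctor A 0).obj T ⟶
      (CategoryTheory.shiftFunctor (DerivedCategory A) i).obj K)) → IsZero K

/-- The right class `E` of the pair induced by `T`: all `X` with `Ext^i(T, X) = 0` for `i > 0`. -/
def tiltingClass [HasExt.{w} A] (T : A) : ObjectProperty A :=
  fun X => ∀ i : ℕ, 0 < i → Subsingleton (Abelian.Ext.{w} T X i)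

/-- The class of all `X` with `Ext^1(X, E) = 0` for all `E` in the given class. -/
def leftExtOrthogonal [HasExt.{w} A] (E : ObjectProperty A) : ObjectProperty A :=
  fun X => ∀ Y : A, E Y → Subsingleton (Abelian.Ext.{w} X Y 1)

/-- The left class `L` of the pair induced by `T`. -/
def leftTiltingClass [HasExt.{w} A] (T : A) : ObjectProperty A :=
  leftExtOrthogonal.{w} (tiltingClass.{w} T)

end Tilting

end TiltingEnochs

/-! The core case is a direct system `F` with terms in L ∩ E. Let P be the coproduct of its terms, p
: P → colim F the projection, and K_j the kernel of ∐_{i ≤ j} F_i → F_j, so that ker p is the direct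
limit of the K_j. As ker p lies in E, a cover l : Y → colim F lifts to s : Y → P; as P lies in L, p
factors as P → Y → colim F. The endomorphism `absorb F j` of P, which pushes the summands of index
at most j into the summand of index j, lies over colim F and kills K_j. Hence Y → P → P/K_j → P → Y
is an endomorphism over l, so an automorphism, and Y → P/K_j is mono. Exactness of direct limits
makes l mono; it is also epi, so colim F ≅ Y is in L.

An arbitrary system in L is handled by induction on a bound m above which Ext(T, -) vanishes on the
terms, starting from the projective dimension n. Special preenvelopes into E are glued to an exact
sequence 0 → F → G → H → 0 of systems in L with a smaller bound for G and H, and L is closed under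
kernels of epimorphisms.

The facts needed about E and L (preenvelopes, presentations by T^(I), closure of E under coproducts
and direct limits) rest on `VanishesAbove.isLE`. Repeatedly coning off all morphisms from the top
shift of T gives a sequence of complexes whose colimit is zero: finite projective dimension takes
the place of compactness of T, and T generates the derived category. -/

namespace TiltingEnochs

open CategoryTheory CategoryTheory.Limits

/-! ### Exact colimits of quasi-isomorphisms -/

section QuasiIsoColimits

variable {A : Type*} [Category* A] [Abelian A] {J : Type*} [Category* J]
  {ι : Type*} {c : ComplexShape ι}

/-- The short complex in `J ⥤ A` in degree `i` attached to a diagram of complexes. -/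
noncomputable def diagramShortComplex (F : J ⥤ HomologicalComplex A c) (i : ι) :
    ShortComplex (J ⥤ A) where
  X₁ := F ⋙ HomologicalComplex.eval A c (c.prev i)
  X₂ := F ⋙ HomologicalComplex.eval A c i
  X₃ := F ⋙ HomologicalComplex.eval A c (c.next i)
  f := { app := fun j => (F.obj j).d _ _, naturality := fun _ _ f => (F.map f).comm _ _ }
  g := { app := fun j => (F.obj j).d _ _, naturality := fun _ _ f => (F.map f).comm _ _ }
  zero := by ext j; exact (F.obj j).d_comp_d _ _ _

/-- The functoriality of `diagramShortComplex`. -/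
noncomputable def diagramShortComplexMap {F G : J ⥤ HomologicalComplex A c} (φ : F ⟶ G) (i : ι) :
    diagramShortComplex F i ⟶ diagramShortComplex G i where
  τ₁ := Functor.whiskerRight φ _
  τ₂ := Functor.whiskerRight φ _
  τ₃ := Functor.whiskerRight φ _
  comm₁₂ := by ext j; exact (φ.app j).comm _ _
  comm₂₃ := by ext j; exact (φ.app j).comm _ _

variable [HasColimitsOfShape J A]

/-- The colimit of a diagram of complexes is computed degreewise. -/
noncomputable def colimitEvalIso (F : J ⥤ HomologicalComplex A c) {cF : Cocone F}
    (hF : IsColimit cF) (i : ι) :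
    colim.obj (F ⋙ HomologicalComplex.eval A c i) ≅ cF.pt.X i :=
  (colimit.isColimit _).coconePointUniqueUpToIso
      (isColimitOfPreserves (HomologicalComplex.eval A c i) hF)

theorem ι_colimitEvalIso_hom (F : J ⥤ HomologicalComplex A c) {cF : Cocone F}
    (hF : IsColimit cF) (i : ι) (j : J) :
    colimit.ι (F ⋙ HomologicalComplex.eval A c i) j ≫ (colimitEvalIso F hF i).hom =
      (cF.ι.app j).f i :=
  colimit.comp_coconePointUniqueUpToIso_hom
    (isColimitOfPreserves (HomologicalComplex.eval A c i) hF) j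

theorem ι_colimitEvalIso_hom_assoc (F : J ⥤ HomologicalComplex A c) {cF : Cocone F}
    (hF : IsColimit cF) (i : ι) (j : J) {W : A} (g : cF.pt.X i ⟶ W) :
    colimit.ι (F ⋙ HomologicalComplex.eval A c i) j ≫ (colimitEvalIso F hF i).hom ≫ g =
      (cF.ι.app j).f i ≫ g :=
  (Category.assoc _ _ _).symm.trans (congrArg (· ≫ g) (ι_colimitEvalIso_hom F hF i j))

variable [HasExactColimitsOfShape J A]

/-- The colimit of `diagramShortComplex` is the short complex of the colimit. -/
noncomputable def colimShortComplexIso (F : J ⥤ HomologicalComplex A c) {cF : Cocone F}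
    (hF : IsColimit cF) (i : ι) :
    (colim (J := J) (C := A)).mapShortComplex.obj (diagramShortComplex F i) ≅
      (HomologicalComplex.shortComplexFunctor A c i).obj cF.pt :=
  ShortComplex.isoMk (colimitEvalIso F hF _) (colimitEvalIso F hF _) (colimitEvalIso F hF _)
    (colimit.hom_ext fun j => by
      dsimp [diagramShortComplex]
      erw [ι_colimitEvalIso_hom_assoc, ι_colimMap_assoc, ι_colimitEvalIso_hom]
      exact (cF.ι.app j).comm _ _)
    (colimit.hom_ext fun j => by
      dsimp [diagramShortComplex]
      erw [ι_colimitEvalIso_hom_assoc, ι_colimMap_assoc, ι_colimitEvalIso_hom]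
      exact (cF.ι.app j).comm _ _)

/-- A colimit, of a shape for which colimits are exact, of quasi-isomorphisms is a
quasi-isomorphism. -/
theorem quasiIsoAt_of_isColimit {F G : J ⥤ HomologicalComplex A c} (φ : F ⟶ G) {cF : Cocone F}
    (hF : IsColimit cF) {cG : Cocone G} (hG : IsColimit cG) (f : cF.pt ⟶ cG.pt)
    (hf : ∀ j, cF.ι.app j ≫ f = φ.app j ≫ cG.ι.app j) (i : ι)
    (hφ : ∀ j, QuasiIsoAt (φ.app j) i) : QuasiIsoAt f i := by
  have hψ : ShortComplex.QuasiIso (diagramShortComplexMap φ i) := by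
    rw [ShortComplex.quasiIso_iff, NatTrans.isIso_iff_isIso_app]
    intro j
    have h1 : ShortComplex.QuasiIso
        (((evaluation J A).obj j).mapShortComplex.map (diagramShortComplexMap φ i)) :=
      (quasiIsoAt_iff _ _).1 (hφ j)
    rw [ShortComplex.quasiIso_iff] at h1
    have e := ShortComplex.mapHomologyIso_hom_naturality (diagramShortComplexMap φ i)
      ((evaluation J A).obj j)
    have : IsIso (((evaluation J A).obj j).map
        (ShortComplex.homologyMap (diagramShortComplexMap φ i))) := by
      replace e := (Iso.inv_comp_eq _).2 e
      rw [← e]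
      exact IsIso.comp_isIso' inferInstance (IsIso.comp_isIso' h1 inferInstance)
    exact this
  have h2 : ShortComplex.QuasiIso
      ((colim (J := J) (C := A)).mapShortComplex.map (diagramShortComplexMap φ i)) :=
    inferInstance
  rw [quasiIsoAt_iff]
  have key (k : ι) : (colimitEvalIso F hF k).hom ≫ f.f k =
      colim.map (Functor.whiskerRight φ (HomologicalComplex.eval A c k)) ≫
        (colimitEvalIso G hG k).hom := colimit.hom_ext fun j => by
    have := congrArg (fun g => HomologicalComplex.Hom.f g k) (hf j)
    erw [ι_colimitEvalIso_hom_assoc, ι_colimMap_assoc, ι_colimitEvalIso_hom]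
    exact this
  refine (ShortComplex.quasiIso_iff_of_arrow_mk_iso _ _ (Arrow.isoMk (colimShortComplexIso F hF i)
    (colimShortComplexIso G hG i) ?_)).1 h2
  ext
  · exact key _
  · exact key _
  · exact key _

end QuasiIsoColimits

/-! ### Stupid truncations -/

section StupidTruncation

variable {A : Type*} [Category* A] [Abelian A]

open ComplexShape

/-- The stupid truncation `≤ m` of a cochain complex. -/
noncomputable abbrev stupidLE (K : CochainComplex A ℤ) (m : ℤ) : CochainComplex A ℤ :=
  (K.restriction (embeddingUpIntLE m)).extend (embeddingUpIntLE m)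

/-- Every predecessor of an index at most m is again at most m, so no differential enters from
outside and the condition is vacuous. -/
theorem hasLift_embeddingUpIntLE (K : CochainComplex A ℤ) (m : ℤ) :
    (embeddingUpIntLE m).HasLift (𝟙 (K.restriction (embeddingUpIntLE m))) := fun _ hj _ hi => by
  obtain ⟨k, hk⟩ := (embeddingUpIntLE m).mem_prev hi
  exact (hj.notMem hi k hk).elim

/-- The projection of a cochain complex onto its stupid truncation. -/
noncomputable def toStupidLE (K : CochainComplex A ℤ) (m : ℤ) : K ⟶ stupidLE K m :=
  (embeddingUpIntLE m).liftExtend (𝟙 _) (hasLift_embeddingUpIntLE K m)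

theorem isIso_toStupidLE_f (K : CochainComplex A ℤ) {m i : ℤ} (hi : i ≤ m) :
    IsIso ((toStupidLE K m).f i) := by
  obtain ⟨k, rfl⟩ := Int.le.dest hi
  refine ((embeddingUpIntLE _).isIso_liftExtend_f_iff (i := k) _ _ (by simp)).2 ?_
  dsimp
  infer_instance

theorem toStupidLE_naturality {K L : CochainComplex A ℤ} (f : K ⟶ L) (m : ℤ) :
    toStupidLE K m ≫ HomologicalComplex.extendMap
      (HomologicalComplex.restrictionMap f (embeddingUpIntLE m)) (embeddingUpIntLE m) =
      f ≫ toStupidLE L m := by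
  apply ((embeddingUpIntLE m).homEquiv _ _).injective
  ext1
  simp only [Embedding.homEquiv_apply_coe]
  rw [Embedding.homRestrict_comp_extendMap, Embedding.homRestrict_precomp]
  rw [toStupidLE, toStupidLE, Embedding.homRestrict_liftExtend, Embedding.homRestrict_liftExtend,
    Category.id_comp, Category.comp_id]

theorem isStrictlyLE_stupidLE (K : CochainComplex A ℤ) (m : ℤ) :
    (stupidLE K m).IsStrictlyLE m := by
  infer_instance

theorem isIso_toStupidLE (K : CochainComplex A ℤ) (m : ℤ) [K.IsStrictlyLE m] :
    IsIso (toStupidLE K m) := by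
  have : ∀ i, IsIso ((toStupidLE K m).f i) := fun i => by
    by_cases hi : i ≤ m
    · exact isIso_toStupidLE_f K hi
    · have := isStrictlyLE_stupidLE K m
      exact ⟨0, (K.isZero_of_isStrictlyLE m i (by lia)).eq_of_src _ _,
        ((stupidLE K m).isZero_of_isStrictlyLE m i (by lia)).eq_of_src _ _⟩
  exact HomologicalComplex.Hom.isIso_of_components _

/-- For i < m the three terms computing cohomology in degree i lie in degrees at most m, where the
projection is an isomorphism. -/
theorem isGE_stupidLE (K : CochainComplex A ℤ) (m : ℤ) [K.IsGE m] : (stupidLE K m).IsGE m := by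
  rw [CochainComplex.isGE_iff]
  intro i hi
  have : QuasiIsoAt (toStupidLE K m) i := by
    rw [quasiIsoAt_iff' _ (i - 1) i (i + 1) (by simp) (by simp)]
    let φ := (HomologicalComplex.shortComplexFunctor' A (up ℤ) (i - 1) i (i + 1)).map
      (toStupidLE K m)
    have : IsIso φ.τ₁ := isIso_toStupidLE_f K (by lia)
    have : IsIso φ.τ₂ := isIso_toStupidLE_f K (by lia)
    have : IsIso φ.τ₃ := isIso_toStupidLE_f K (by lia)
    exact ShortComplex.quasiIso_of_epi_of_isIso_of_mono φ
  exact (exactAt_iff_of_quasiIsoAt (toStupidLE K m) i).1 (K.exactAt_of_isGE m i hi)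

end StupidTruncation

/-! ### Morphisms in the derived category out of shifted objects -/

section Derived

variable {A : Type u} [Category.{v} A] [Abelian A] [HasDerivedCategory.{w} A]

open DerivedCategory

/-- Shifting the source of a morphism from an object of the heart. -/
noncomputable def singleHomShiftEquiv (X : A) (K : DerivedCategory A) (j a i : ℤ)
    (h : a + i = j) :
    ((singleFunctor A i).obj X ⟶ K⟦a⟧) ≃ ((singleFunctor A j).obj X ⟶ K) :=
  ((((singleFunctors A).shiftIso a i j h).app X).homCongr (Iso.refl (K⟦a⟧))).symm.trans
    (Functor.FullyFaithful.ofFullyFaithful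
      (shiftFunctor (DerivedCategory A) a)).homEquiv.symm

/-- Morphisms between shifts of objects are elements of `Ext` groups. -/
noncomputable def singleHomEquivExt [HasExt.{w'} A] (X Y : A) (j m : ℤ) (k : ℕ) (h : m + k = j) :
    ((singleFunctor A j).obj X ⟶ (singleFunctor A m).obj Y) ≃ Abelian.Ext.{w'} X Y k :=
  (singleHomShiftEquiv X ((singleFunctor A m).obj Y) j j 0 (by lia)).symm.trans
    ((Iso.homCongr (Iso.refl _)
      (((singleFunctors A).shiftIso j (-k) m (by lia)).app Y ≪≫
        (((singleFunctors A).shiftIso k (-k) 0 (by lia)).app Y).symm)).trans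
      Abelian.Ext.homEquiv.symm)

/-- An object of projective dimension at most `n` has no nonzero morphisms to complexes, possibly
unbounded below, that are far enough to the left. -/
theorem subsingleton_singleHom_of_isLE (T : A) (n : ℕ) [HasProjectiveDimensionLE T n]
    (K : DerivedCategory A) (m j : ℤ) [K.IsLE m] (h : m + n < j) :
    Subsingleton ((singleFunctor A j).obj T ⟶ K) := by
  obtain ⟨M, hM, ⟨e⟩⟩ := K.exists_iso_Q_obj_of_isLE m
  suffices ∀ f : Q.obj ((CochainComplex.singleFunctor A j).obj T) ⟶ Q.obj M, f = 0 from
    ⟨fun f g => by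
      rw [← cancel_mono e.hom]
      exact (this _).trans (this _).symm⟩
  intro f
  obtain ⟨R, s, hs, g, rfl⟩ := right_fac f
  have hR : R.IsGE m := by
    rw [← isGE_Q_obj_iff]
    have : (Q.obj ((CochainComplex.singleFunctor A j).obj T)).IsGE m := by
      rw [isGE_Q_obj_iff]
      exact CochainComplex.isGE_of_ge _ m j (by lia)
    exact TStructure.t.isGE_of_iso (asIso (Q.map s)).symm m
  have := isIso_toStupidLE M m
  -- `M` vanishes above m, so g only sees the stupid truncation of `R`.
  have hg : g = toStupidLE R m ≫ HomologicalComplex.extendMap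
      (HomologicalComplex.restrictionMap g (ComplexShape.embeddingUpIntLE m))
        (ComplexShape.embeddingUpIntLE m) ≫ inv (toStupidLE M m) := by
    rw [← Category.assoc, toStupidLE_naturality, Category.assoc, IsIso.hom_inv_id,
      Category.comp_id]
  -- `R` has no cohomology below m, so its truncation is a single object S placed in degree m. The
  -- morphism from T to it is a class in Ext^{j-m}(T, S), with j - m > n.
  have := isGE_stupidLE R m
  have := isStrictlyLE_stupidLE R m
  obtain ⟨S, ⟨e'⟩⟩ := exists_iso_singleFunctor_obj_of_isGE_of_isLE (Q.obj (stupidLE R m)) m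
  have hS : Subsingleton ((singleFunctor A j).obj T ⟶ (singleFunctor A m).obj S) := by
    have := HasExt.standard A
    have := HasProjectiveDimensionLT.subsingleton.{max u v} T (n + 1) (j - m).toNat (by lia) S
    exact (singleHomEquivExt T S j m (j - m).toNat (by lia)).subsingleton
  have h0 : (inv (Q.map s) ≫ Q.map (toStupidLE R m)) = 0 := by
    rw [← cancel_mono e'.hom]
    exact Subsingleton.elim (α := ((singleFunctor A j).obj T ⟶ (singleFunctor A m).obj S)) _ _
  rw [hg, Q.map_comp, ← Category.assoc, h0, zero_comp]

/-- Morphisms from a coproduct of objects of the heart can be constructed componentwise. -/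
theorem exists_singleHom_sigma {I : Type w'} [HasCoproductsOfShape I A]
    [HasExactColimitsOfShape (Discrete I) A] (X : I → A) (d : ℤ) (K : DerivedCategory A)
    (f : ∀ i, (singleFunctor A d).obj (X i) ⟶ K) :
    ∃ g : (singleFunctor A d).obj (∐ X) ⟶ K,
      ∀ i, (singleFunctor A d).map (Sigma.ι X i) ≫ g = f i := by
  let e : Q.obj (Q.objPreimage K) ≅ K := Q.objObjPreimageIso K
  let f' (i : I) : Q.obj ((CochainComplex.singleFunctor A d).obj (X i)) ⟶ K := f i
  have H (i : I) := right_fac (f' i ≫ e.inv)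
  choose R s hs g hg using H
  have hc : IsColimit (Cofan.mk ((CochainComplex.singleFunctor A d).obj (∐ X))
      fun i => (CochainComplex.singleFunctor A d).map (Sigma.ι X i)) :=
    (isColimitMapCoconeCofanMkEquiv (HomologicalComplex.single A (ComplexShape.up ℤ) d) X _)
      (isColimitOfPreserves _ (coproductIsCoproduct X))
  let t : ∐ R ⟶ (CochainComplex.singleFunctor A d).obj (∐ X) :=
    Sigma.desc fun i => s i ≫ (CochainComplex.singleFunctor A d).map (Sigma.ι X i)
  -- The denominators can be summed because coproducts are exact.
  have ht : QuasiIso t := ⟨fun k => quasiIsoAt_of_isColimit (Discrete.natTrans fun i => s i.as)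
    (coproductIsCoproduct R) hc t (fun i => by simp [t]) k
      fun i => by
        have := (isIso_Q_map_iff_quasiIso _ _).1 (hs i.as)
        dsimp
        infer_instance⟩
  have : IsIso (Q.map t) := (isIso_Q_map_iff_quasiIso _ _).2 ht
  let g' : Q.obj ((CochainComplex.singleFunctor A d).obj (∐ X)) ⟶ K :=
    inv (Q.map t) ≫ Q.map (Sigma.desc g) ≫ e.hom
  suffices ∀ i, Q.map ((CochainComplex.singleFunctor A d).map (Sigma.ι X i)) ≫ g' = f' i from
    ⟨g', this⟩
  intro i
  have h1 : Q.map (s i) ≫ Q.map ((CochainComplex.singleFunctor A d).map (Sigma.ι X i)) =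
      Q.map (Sigma.ι R i) ≫ Q.map t := by
    rw [← Q.map_comp, ← Q.map_comp, Sigma.ι_desc]
  rw [← cancel_mono e.inv, hg, ← cancel_epi (Q.map (s i))]
  simp only [g', Category.assoc, IsIso.hom_inv_id_assoc, reassoc_of% h1, Iso.hom_inv_id,
    Category.comp_id]
  rw [← Q.map_comp, Sigma.ι_desc]

/-- A morphism from a coproduct of objects of the heart vanishes if its components do. -/
theorem singleHom_sigma_eq_zero {I : Type w'} [HasCoproductsOfShape I A]
    [HasExactColimitsOfShape (Discrete I) A] (X : I → A) (d : ℤ) {K : DerivedCategory A}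
    (g : (singleFunctor A d).obj (∐ X) ⟶ K)
    (hg : ∀ i, (singleFunctor A d).map (Sigma.ι X i) ≫ g = 0) : g = 0 := by
  -- Uniqueness follows from existence: the inclusions lift to the fibre `F` of g and assemble to b.
  -- Full faithfulness on objects gives `b ≫ p = 𝟙`, whence g = b ≫ p ≫ g = 0.
  obtain ⟨F, p, q, hT⟩ := Pretriangulated.distinguished_cocone_triangle₁ g
  choose a ha using fun i => Pretriangulated.Triangle.coyoneda_exact₂ _ hT _ (hg i)
  obtain ⟨b, hb⟩ := exists_singleHom_sigma X d F a
  have h1 : b ≫ p = 𝟙 _ := by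
    obtain ⟨c, hc⟩ := (singleFunctor A d).map_surjective (b ≫ p)
    rw [← hc, ← (singleFunctor A d).map_id]
    congr 1
    refine Sigma.hom_ext _ _ fun i => (singleFunctor A d).map_injective ?_
    rw [Functor.map_comp, hc, ← Category.assoc, hb, Category.comp_id]
    exact (ha i).symm
  rw [← Category.id_comp g, ← h1, Category.assoc]
  have : p ≫ g = 0 := Pretriangulated.comp_distTriang_mor_zero₁₂ _ hT
  rw [this, comp_zero]

end Derived

/-! ### Cohomology and smallness in distinguished triangles -/

section HomologyTriangles

variable {A : Type u} [Category.{v} A] [Abelian A] [HasDerivedCategory.{w} A]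

open DerivedCategory Pretriangulated

theorem isZero_homology_single (X : A) (d j : ℤ) (h : j ≠ d) :
    IsZero ((homologyFunctor A j).obj ((singleFunctor A d).obj X)) := by
  rcases lt_or_gt_of_ne h with h | h
  · exact isZero_of_isGE _ d j h
  · exact isZero_of_isLE _ d j h

theorem isIso_homologyMap_mor₂ (S : Triangle (DerivedCategory A)) (hS : S ∈ distTriang _) (j : ℤ)
    (h₀ : IsZero ((homologyFunctor A j).obj S.obj₁))
    (h₁ : IsZero ((homologyFunctor A (j + 1)).obj S.obj₁)) :
    IsIso ((homologyFunctor A j).map S.mor₂) := by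
  have := (HomologySequence.mono_homologyMap_mor₂_iff S hS j).2 (h₀.eq_of_src _ _)
  have := (HomologySequence.epi_homologyMap_mor₂_iff S hS j (j + 1)).2 (h₁.eq_of_tgt _ _)
  exact isIso_of_mono_of_epi _

theorem isZero_homology_obj₃ (S : Triangle (DerivedCategory A)) (hS : S ∈ distTriang _) (j : ℤ)
    (h₀ : Epi ((homologyFunctor A j).map S.mor₁))
    (h₁ : Mono ((homologyFunctor A (j + 1)).map S.mor₁)) :
    IsZero ((homologyFunctor A j).obj S.obj₃) := by
  refine (HomologySequence.exact₃ S hS j (j + 1)).isZero_X₂ ?_ ?_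
  · exact (HomologySequence.epi_homologyMap_mor₁_iff S hS j).1 h₀
  · exact (HomologySequence.mono_homologyMap_mor₁_iff S hS j (j + 1)).1 h₁

/-- Morphisms with the same image under `S.mor₃` differ by one coming from `S.obj₂`. This keeps the
coproducts of copies of T built below indexed by small sets. -/
theorem small_hom_obj₃ (S : Triangle (DerivedCategory A)) (hS : S ∈ distTriang _)
    (W : DerivedCategory A) (h₂ : Small.{w'} (W ⟶ S.obj₂)) (h₁ : Small.{w'} (W ⟶ S.obj₁⟦(1 : ℤ)⟧)) :
    Small.{w'} (W ⟶ S.obj₃) := by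
  let R := Set.range fun f : W ⟶ S.obj₃ => f ≫ S.mor₃
  have hR : Small.{w'} (R × (W ⟶ S.obj₂)) := inferInstance
  let p : R × (W ⟶ S.obj₂) → (W ⟶ S.obj₃) := fun x => x.1.2.choose + x.2 ≫ S.mor₂
  refine @small_of_surjective _ _ hR p fun f => ?_
  let c : R := ⟨f ≫ S.mor₃, f, rfl⟩
  have hc : c.2.choose ≫ S.mor₃ = f ≫ S.mor₃ := c.2.choose_spec
  obtain ⟨a, ha⟩ := Triangle.coyoneda_exact₃ S hS (f - c.2.choose) (by
    rw [Preadditive.sub_comp, hc, sub_self])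
  exact ⟨(c, a), (sub_eq_iff_eq_add'.1 ha).symm⟩

/-- A morphism in the derived category out of a complex is represented by a morphism of
complexes. -/
theorem exists_Q_map_eq (M : CochainComplex A ℤ) (K : DerivedCategory A) (α : Q.obj M ⟶ K) :
    ∃ (N : CochainComplex A ℤ) (φ : M ⟶ N) (e : K ≅ Q.obj N), α ≫ e.hom = Q.map φ := by
  obtain ⟨N, φ, s, hs, h⟩ := left_fac (α ≫ (Q.objObjPreimageIso K).inv)
  refine ⟨N, φ, (Q.objObjPreimageIso K).symm ≪≫ asIso (Q.map s), ?_⟩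
  simp [reassoc_of% h]

theorem quasiIsoAt_of_isIso_homology {M N : CochainComplex A ℤ} (φ : M ⟶ N) (j : ℤ)
    (h : IsIso ((homologyFunctor A j).map (Q.map φ))) : QuasiIsoAt φ j := by
  rw [quasiIsoAt_iff_isIso_homologyMap]
  exact (NatIso.isIso_map_iff (homologyFunctorFactors A j) φ).1 h

theorem isIso_homology_of_quasiIsoAt {M N : CochainComplex A ℤ} (φ : M ⟶ N) (j : ℤ)
    (h : QuasiIsoAt φ j) : IsIso ((homologyFunctor A j).map (Q.map φ)) := by
  rw [quasiIsoAt_iff_isIso_homologyMap] at h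
  exact (NatIso.isIso_map_iff (homologyFunctorFactors A j) φ).2 h

end HomologyTriangles

/-! ### Sequential colimits of complexes -/

section Sequences

variable {A : Type u} [Category.{v} A] [HasColimits A] [AB5 A]

theorem ab5OfSize_zero : AB5OfSize.{0, 0} A := AB5OfSize_of_univLE.{0, 0, v, v} A

variable [Abelian A]

attribute [local instance] IsFiltered.isConnected

/-- If the transition maps of a sequence of complexes are quasi-isomorphisms in degree `j` from
rank `r` on, then so is the map from its `r`-th term to the colimit. -/
theorem quasiIsoAt_ι_of_sequence (F : ℕ ⥤ CochainComplex A ℤ) (r : ℕ) (j : ℤ)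
    (h : ∀ s (hs : r ≤ s), QuasiIsoAt (F.map (homOfLE hs)) j) :
    QuasiIsoAt (colimit.ι F r) j := by
  have := ab5OfSize_zero (A := A)
  -- The constant diagram is compared with the tail of the sequence, which is final.
  let φ : (Functor.const _).obj (F.obj r) ⟶ Under.forget r ⋙ F :=
    { app s := F.map s.hom
      naturality _ _ g := by
        dsimp
        simp only [Category.id_comp, ← F.map_comp, Under.w] }
  exact quasiIsoAt_of_isColimit φ (isColimitConstCocone _ _)
    ((Functor.Final.isColimitWhiskerEquiv (Under.forget r) _).symm (colimit.isColimit F))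
    (colimit.ι F r) (fun s => (Category.id_comp _).trans (colimit.w F s.hom).symm) j
    (fun s => h _ (leOfHom s.hom))

end Sequences

theorem hasExactColimitsOfShape_discrete {A : Type u} [Category.{v} A] [Abelian A]
    [HasColimits A] [AB5 A] (I : Type v) : HasExactColimitsOfShape (Discrete I) A :=
  have := Abelian.hasFiniteBiproducts (C := A)
  hasExactColimitsOfShape_discrete_of_hasExactColimitsOfShape_finset_discrete A I

/-! ### Killing morphisms from shifts of T -/

section TiltingDerived

variable {A : Type u} [Category.{v} A] [Abelian A] [HasColimits A] [AB5 A] [HasExt.{v} A]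
  [HasDerivedCategory.{w} A]

open DerivedCategory Pretriangulated

/-- The complex `K` has small groups of morphisms from shifts of `T`, which vanish in degrees
larger than `d`. -/
def VanishesAbove (T : A) (d : ℤ) (K : DerivedCategory A) : Prop :=
  (∀ j : ℤ, Small.{v} ((singleFunctor A j).obj T ⟶ K)) ∧
    ∀ j : ℤ, d < j → Subsingleton ((singleFunctor A j).obj T ⟶ K)

theorem VanishesAbove.of_iso {A : Type u} [Category.{v} A] [Abelian A]
    [HasDerivedCategory.{w} A] {T : A} {d : ℤ} {K K' : DerivedCategory A}
    (h : VanishesAbove T d K) (e : K ≅ K') : VanishesAbove T d K' :=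
  ⟨fun j => (small_congr ((Iso.refl _).homCongr e)).1 (h.1 j),
    fun j hj => have := h.2 j hj; ((Iso.refl _).homCongr e).symm.subsingleton⟩

variable {n : ℕ} {T : A}

theorem vanishesAbove_sigma {A : Type u} [Category.{v} A] [Abelian A]
    [HasCoproducts.{v} A] [HasExt.{v} A] [HasDerivedCategory.{w} A] {n : ℕ} {T : A}
    (hT : IsTilting.{v} n T) (I : Type v) (d : ℤ) :
    VanishesAbove T d ((singleFunctor A d).obj (∐ fun _ : I => T)) := by
  refine ⟨fun j => inferInstance, fun j hj => ?_⟩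
  have := hT.ext_coproduct I (j - d).toNat (by lia)
  exact (singleHomEquivExt T _ j d (j - d).toNat (by lia)).subsingleton

/-- Killing the top nonvanishing group of morphisms from shifts of `T`. -/
theorem exists_triangle_vanishesAbove (hT : IsTilting.{v} n T) {d : ℤ} {K : DerivedCategory A}
    (hK : VanishesAbove T d K) (d' : ℤ) (hd : d' + 1 = d) :
    ∃ (I : Type v) (K' : DerivedCategory A)
      (p : (singleFunctor A d).obj (∐ fun _ : I => T) ⟶ K) (q : K ⟶ K')
      (r : K' ⟶ ((singleFunctor A d).obj (∐ fun _ : I => T))⟦(1 : ℤ)⟧),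
      Triangle.mk p q r ∈ distTriang _ ∧
      (∀ f : (singleFunctor A d).obj T ⟶ K,
        ∃ i : I, f = (singleFunctor A d).map (Sigma.ι (fun _ : I => T) i) ≫ p) ∧
      VanishesAbove T d' K' := by
  have := hK.1 d
  let I := Shrink.{v} ((singleFunctor A d).obj T ⟶ K)
  have := hasExactColimitsOfShape_discrete (A := A) I
  obtain ⟨p, hp⟩ := exists_singleHom_sigma (fun _ : I => T) d K
    (fun i => (equivShrink _).symm i)
  obtain ⟨K', q, r, h⟩ := distinguished_cocone_triangle p
  have hp' (f : (singleFunctor A d).obj T ⟶ K) :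
      ∃ i : I, f = (singleFunctor A d).map (Sigma.ι (fun _ : I => T) i) ≫ p :=
    ⟨equivShrink _ f, by rw [hp]; simp⟩
  have hS := vanishesAbove_sigma hT I d
  refine ⟨I, K', p, q, r, h, hp', fun j => ?_, fun j hj => ⟨fun f g => ?_⟩⟩
  · exact small_hom_obj₃ _ h _ (hK.1 j) ((small_congr
      (singleHomShiftEquiv T ((singleFunctor A d).obj (∐ fun _ : I => T)) (j + 1) 1 j
        (by lia))).2 (hS.1 (j + 1)))
  · suffices ∀ f : (singleFunctor A j).obj T ⟶ K', f = 0 by rw [this f, this g]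
    intro f
    -- j + 1 > d, so no morphism from T in degree j reaches the shifted coproduct, and f comes from
    -- `K`.
    have := hS.2 (j + 1) (by lia)
    have h1 := (singleHomShiftEquiv T ((singleFunctor A d).obj (∐ fun _ : I => T)) (j + 1) 1 j
        (by lia)).subsingleton
    obtain ⟨a, rfl⟩ := Triangle.coyoneda_exact₃ _ h f (h1.elim _ _)
    change _ ≫ q = 0
    -- In degree d every morphism factors through p by the choice of `I`; above d there is none.
    rcases (show d = j ∨ d < j by lia) with rfl | hj'
    · obtain ⟨i, rfl⟩ := hp' a
      have : p ≫ q = 0 := comp_distTriang_mor_zero₁₂ _ h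
      erw [Category.assoc, this, comp_zero]
    · have ha : a = 0 := (hK.2 j hj').elim _ _
      rw [ha]
      exact zero_comp

/-- The coproduct coned off sits in degree d, so cohomology above d is unchanged. Working with
complexes makes the iterated cones an honest sequence with a colimit. -/
theorem exists_complex_vanishesAbove (hT : IsTilting.{v} n T) {d : ℤ} (M : CochainComplex A ℤ)
    (hM : VanishesAbove T d (Q.obj M)) (d' : ℤ) (hd : d' + 1 = d) :
    ∃ (N : CochainComplex A ℤ) (φ : M ⟶ N), VanishesAbove T d' (Q.obj N) ∧
      ∀ j, d < j → QuasiIsoAt φ j := by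
  obtain ⟨I, K', p, q, r, h, -, hK'⟩ := exists_triangle_vanishesAbove hT hM d' hd
  obtain ⟨N, φ, e, he⟩ := exists_Q_map_eq M K' q
  refine ⟨N, φ, hK'.of_iso e, fun j hj => quasiIsoAt_of_isIso_homology φ j ?_⟩
  have : IsIso ((homologyFunctor A j).map q) := isIso_homologyMap_mor₂ _ h j
    (isZero_homology_single _ _ _ (by lia)) (isZero_homology_single _ _ _ (by lia))
  rw [← he, Functor.map_comp]
  infer_instance

/-- The complexes whose groups of morphisms from shifts of `T` vanish above degree `d` are
cohomologically concentrated in degrees at most `d`. -/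
theorem VanishesAbove.isLE (hT : IsTilting.{v} n T) {d : ℤ} {K : DerivedCategory A}
    (hK : VanishesAbove T d K) : K.IsLE d := by
  obtain ⟨M, ⟨e⟩⟩ : ∃ M, Nonempty (K ≅ Q.obj M) := ⟨_, ⟨(Q.objObjPreimageIso K).symm⟩⟩
  choose N φ hN hφ using fun (r : ℕ)
    (M : { M : CochainComplex A ℤ // VanishesAbove T (d - r) (Q.obj M) }) =>
      exists_complex_vanishesAbove hT M.1 M.2 (d - (r + 1 : ℕ)) (by push_cast; ring)
  let X : ∀ r : ℕ, { M : CochainComplex A ℤ // VanishesAbove T (d - r) (Q.obj M) } := fun r =>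
    Nat.rec ⟨M, by simpa using hK.of_iso e⟩ (fun r M => ⟨N r M, hN r M⟩) r
  -- The r-th term receives no morphisms from T in degrees above d - r.
  let F : ℕ ⥤ CochainComplex A ℤ := Functor.ofSequence (X := fun r => (X r).1)
    (fun r => φ r (X r))
  have hF (r s : ℕ) (hs : r ≤ s) (j : ℤ) (hj : d - r < j) : QuasiIsoAt (F.map (homOfLE hs)) j := by
    induction s, hs using Nat.le_induction with
    | base =>
      have : homOfLE (le_refl r) = 𝟙 r := rfl
      rw [this, F.map_id]
      infer_instance
    | succ s hs ih =>
      have : homOfLE (hs.trans s.le_succ) = homOfLE hs ≫ homOfLE s.le_succ := rfl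
      rw [this, F.map_comp]
      have h1 : QuasiIsoAt (F.map (homOfLE s.le_succ)) j := by
        rw [Functor.ofSequence_map_homOfLE_succ]
        exact hφ s (X s) j (by lia)
      infer_instance
  have hι (r : ℕ) (j : ℤ) (hj : d - r < j) : QuasiIsoAt (colimit.ι F r) j :=
    quasiIsoAt_ι_of_sequence F r j fun s hs => hF r s hs j hj
  have hpd := hT.projectiveDimension_le
  have h0 : IsZero (Q.obj (colimit F)) := by
    refine hT.isZero_of_hom _ fun i => ?_
    suffices Subsingleton ((singleFunctor A i).obj T ⟶ Q.obj (colimit F)) from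
      (singleHomShiftEquiv T _ i i 0 (by lia)).subsingleton
    -- This gives (d - r) + n < i, also when `toNat` truncates to 0. Morphisms from T in degree i
    -- then vanish into the r-th term, and into the cone `R`, which lives in degrees at most d - r.
    let r : ℕ := (d + n + 1 - i).toNat
    obtain ⟨R, q, δ, h⟩ := distinguished_cocone_triangle (Q.map (colimit.ι F r))
    have hR : R.IsLE (d - r) := by
      rw [isLE_iff]
      intro j hj
      have h1 := isIso_homology_of_quasiIsoAt _ _ (hι r j hj)
      have h2 := isIso_homology_of_quasiIsoAt _ _ (hι r (j + 1) (by lia))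
      exact isZero_homology_obj₃ _ h j (@IsIso.epi_of_iso _ _ _ _ _ h1)
        (@IsIso.mono_of_iso _ _ _ _ _ h2)
    have h1 := subsingleton_singleHom_of_isLE T n R (d - r) i (by lia)
    have h2 := (X r).2.2 i (by lia)
    suffices ∀ f : (singleFunctor A i).obj T ⟶ Q.obj (colimit F), f = 0 from
      ⟨fun f g => by rw [this f, this g]⟩
    intro f
    obtain ⟨a, rfl⟩ := Triangle.coyoneda_exact₂ _ h f (h1.elim _ _)
    have : a = 0 := h2.elim _ _
    rw [this]
    exact zero_comp
  rw [isLE_iff]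
  intro j hj
  -- Above d, the cohomology of `K` agrees with that of the zero colimit.
  have h1 := isIso_homology_of_quasiIsoAt _ _ (hι 0 j (by simpa using hj))
  exact (((homologyFunctor A j).map_isZero h0).of_iso
    (asIso ((homologyFunctor A j).map (Q.map (colimit.ι F 0))))).of_iso
      ((homologyFunctor A j).mapIso e)

end TiltingDerived

theorem subsingleton_of_forall_eq_zero {G : Type*} [Zero G] (h : ∀ x : G, x = 0) :
    Subsingleton G :=
  ⟨fun x y => (h x).trans (h y).symm⟩

/-! ### Short exact sequences and Ext -/

section ShortExact

variable {A : Type u} [Category.{v} A] [Abelian A]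

theorem shortExact_kernel {X Y : A} (f : X ⟶ Y) [Epi f] :
    (ShortComplex.mk (kernel.ι f) f (kernel.condition f)).ShortExact where
  exact := ShortComplex.exact_of_f_is_kernel _ (kernelIsKernel f)

theorem shortExact_cokernel {X Y : A} (f : X ⟶ Y) [Mono f] :
    (ShortComplex.mk f (cokernel.π f) (cokernel.condition f)).ShortExact where
  exact := ShortComplex.exact_of_g_is_cokernel _ (cokernelIsCokernel f)

end ShortExact

section ExtSequences

variable {A : Type u} [Category.{v} A] [Abelian A] [HasExt.{w} A] {S : ShortComplex A}

open Abelian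

theorem subsingleton_ext_covariant₁ (hS : S.ShortExact) (X : A) {i j : ℕ} (hij : i + 1 = j)
    (h₃ : Subsingleton (Ext.{w} X S.X₃ i)) (h₂ : Subsingleton (Ext.{w} X S.X₂ j)) :
    Subsingleton (Ext.{w} X S.X₁ j) := by
  refine subsingleton_of_forall_eq_zero fun x => ?_
  obtain ⟨y, rfl⟩ := Ext.covariant_sequence_exact₁ X hS x (h₂.elim _ _) hij
  rw [h₃.elim y 0, Ext.zero_comp]

theorem subsingleton_ext_covariant₃ (hS : S.ShortExact) (X : A) {i j : ℕ} (hij : i + 1 = j)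
    (h₂ : Subsingleton (Ext.{w} X S.X₂ i)) (h₁ : Subsingleton (Ext.{w} X S.X₁ j)) :
    Subsingleton (Ext.{w} X S.X₃ i) := by
  refine subsingleton_of_forall_eq_zero fun x => ?_
  obtain ⟨y, rfl⟩ := Ext.covariant_sequence_exact₃ X hS x hij (h₁.elim _ _)
  rw [h₂.elim y 0, Ext.zero_comp]

theorem subsingleton_ext_contravariant₂ (hS : S.ShortExact) (Y : A) {i : ℕ}
    (h₁ : Subsingleton (Ext.{w} S.X₁ Y i)) (h₃ : Subsingleton (Ext.{w} S.X₃ Y i)) :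
    Subsingleton (Ext.{w} S.X₂ Y i) := by
  refine subsingleton_of_forall_eq_zero fun x => ?_
  obtain ⟨y, rfl⟩ := Ext.contravariant_sequence_exact₂ hS Y x (h₁.elim _ _)
  rw [h₃.elim y 0, Ext.comp_zero]

theorem surjective_hom_of_subsingleton_ext (hS : S.ShortExact) (X : A)
    (h₁ : Subsingleton (Ext.{w} X S.X₁ 1)) (f : X ⟶ S.X₃) : ∃ g : X ⟶ S.X₂, g ≫ S.g = f := by
  obtain ⟨y, hy⟩ := Ext.covariant_sequence_exact₃ X hS (Ext.mk₀ f) (zero_add 1) (h₁.elim _ _)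
  obtain ⟨g, rfl⟩ := Ext.mk₀_bijective _ _ |>.2 y
  exact ⟨g, (Ext.mk₀_bijective _ _).1 (by simpa using hy)⟩

end ExtSequences

/-! ### Approximations by the tilting class -/

section TiltingApproximations

variable {A : Type u} [Category.{v} A] [Abelian A] [HasColimits A] [AB5 A] [HasExt.{v} A]
  [HasDerivedCategory.{w} A] {n : ℕ} {T : A}

open DerivedCategory Pretriangulated

theorem epi_of_epi_homology_single {A : Type u} [Category.{v} A] [Abelian A]
    [HasDerivedCategory.{w} A] {X Y : A} (f : X ⟶ Y) (d : ℤ)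
    (h : Epi ((homologyFunctor A d).map ((singleFunctor A d).map f))) : Epi f :=
  ((MorphismProperty.epimorphisms A).arrow_mk_iso_iff
    ((Arrow.isoMk ((singleFunctorCompHomologyFunctorIso A d).app X)
      ((singleFunctorCompHomologyFunctorIso A d).app Y)
      ((singleFunctorCompHomologyFunctorIso A d).hom.naturality f).symm))).1 h

theorem mono_of_mono_homology_single {A : Type u} [Category.{v} A] [Abelian A]
    [HasDerivedCategory.{w} A] {X Y : A} (f : X ⟶ Y) (d : ℤ)
    (h : Mono ((homologyFunctor A d).map ((singleFunctor A d).map f))) : Mono f :=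
  ((MorphismProperty.monomorphisms A).arrow_mk_iso_iff
    ((Arrow.isoMk ((singleFunctorCompHomologyFunctorIso A d).app X)
      ((singleFunctorCompHomologyFunctorIso A d).app Y)
      ((singleFunctorCompHomologyFunctorIso A d).hom.naturality f).symm))).1 h

/-- Every object of the tilting class is a quotient of a coproduct of copies of `T`, with the
kernel in the tilting class. -/
theorem exists_epi_of_tiltingClass (hT : IsTilting.{v} n T) {X : A} (hX : tiltingClass.{v} T X) :
    ∃ (I : Type v) (π : (∐ fun _ : I => T) ⟶ X), Epi π ∧ tiltingClass.{v} T (kernel π) := by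
  have hK : VanishesAbove T 0 ((singleFunctor A 0).obj X) := by
    refine ⟨fun j => inferInstance, fun j hj => ?_⟩
    have := hX j.toNat (by lia)
    exact (singleHomEquivExt T X j 0 j.toNat (by lia)).subsingleton
  obtain ⟨I, K', p, q, r, h, hp, hK'⟩ := exists_triangle_vanishesAbove hT hK (-1) (by lia)
  obtain ⟨π, rfl⟩ := (singleFunctor A 0).map_surjective p
  -- The cone has no cohomology in degree 0, which makes π epi.
  have := hK'.isLE hT
  have hπ : Epi π := epi_of_epi_homology_single π 0
    ((HomologySequence.epi_homologyMap_mor₁_iff _ h 0).2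
      ((isZero_of_isLE K' (-1) 0 (by lia)).eq_of_tgt _ _))
  refine ⟨I, π, hπ, fun i hi => subsingleton_of_forall_eq_zero fun x => ?_⟩
  have hS := shortExact_kernel π
  obtain ⟨j, rfl⟩ : ∃ j, i = j + 1 := ⟨i - 1, by lia⟩
  obtain ⟨y, rfl⟩ := Abelian.Ext.covariant_sequence_exact₁ T hS x
    ((hT.ext_coproduct I (j + 1) hi).elim _ _) rfl
  -- For Ext^1 of the kernel: every morphism T → X lifts along π, so its connecting class is zero.
  rcases Nat.eq_zero_or_pos j with rfl | hj
  · obtain ⟨g, rfl⟩ := Abelian.Ext.mk₀_bijective _ _ |>.2 y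
    obtain ⟨i, hi⟩ := hp ((singleFunctor A 0).map g)
    obtain rfl : g = Sigma.ι (fun _ : I => T) i ≫ π :=
      (singleFunctor A 0).map_injective (by simpa using hi)
    rw [← Abelian.Ext.mk₀_comp_mk₀, Abelian.Ext.comp_assoc_of_second_deg_zero]
    have := hS.comp_extClass
    dsimp at this
    rw [this, Abelian.Ext.comp_zero]
  · rw [(hX j hj).elim y 0, Abelian.Ext.zero_comp]

/-- Killing the morphisms from shifts of `T` in positive degrees, without changing the morphisms
to objects of the tilting class. -/
theorem exists_hom_vanishesAbove_zero (hT : IsTilting.{v} n T) (k : ℕ) (K : DerivedCategory A)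
    [K.IsGE 0] (hK : VanishesAbove T k K) :
    ∃ (K' : DerivedCategory A) (α : K ⟶ K'), Mono ((homologyFunctor A 0).map α) ∧
      K'.IsGE 0 ∧ VanishesAbove T 0 K' ∧ ∀ Y, tiltingClass.{v} T Y →
        (∀ f : K ⟶ (singleFunctor A 0).obj Y, ∃ g, α ≫ g = f) ∧
        ∀ g : K' ⟶ (singleFunctor A (-1)).obj Y, α ≫ g = 0 → g = 0 := by
  induction k generalizing K with
  | zero =>
    refine ⟨K, 𝟙 K, inferInstance, inferInstance, hK, fun Y hY => ⟨fun f => ⟨f, by simp⟩,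
      fun g hg => by simpa using hg⟩⟩
  | succ k ih =>
    obtain ⟨I, K₁, p, q, r, h, -, hK₁⟩ := exists_triangle_vanishesAbove hT hK k (by simp)
    have := hasExactColimitsOfShape_discrete (A := A) I
    -- The coproduct lies in degree k + 1, so its cone contributes only in degree k ≥ 0. Stopping
    -- before degree 0 is killed is what preserves this bound.
    have hGE : K₁.IsGE 0 := by
      rw [isGE_iff]
      intro j hj
      exact (HomologySequence.exact₃ _ h j (j + 1)).isZero_X₂
        ((isZero_of_isGE K 0 j hj).eq_of_src _ _)
        ((isZero_homology_single _ _ _ (by push_cast; lia)).eq_of_tgt _ _)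
    have hq : Mono ((homologyFunctor A 0).map q) :=
      (HomologySequence.mono_homologyMap_mor₂_iff _ h 0).2
        ((isZero_homology_single _ _ _ (by push_cast; lia)).eq_of_src _ _)
    obtain ⟨K₂, α, hα, hK₂, hK₂', H⟩ := ih K₁ hK₁
    -- These are Ext^{d-m} classes from a coproduct of copies of T. The case d = k + 1, m = 0
    -- extends morphisms to Y; the case d = k, m = -1, after a shift, gives the second property.
    have hzero (Y : A) (hY : tiltingClass.{v} T Y) (d m : ℤ) (hm : m < d)
        (f : (singleFunctor A d).obj (∐ fun _ : I => T) ⟶ (singleFunctor A m).obj Y) : f = 0 := by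
      refine singleHom_sigma_eq_zero _ _ _ fun i => ?_
      have := hY (d - m).toNat (by lia)
      exact (singleHomEquivExt T Y d m (d - m).toNat (by lia)).subsingleton.elim _ _
    refine ⟨K₂, q ≫ α, ?_, hK₂, hK₂', fun Y hY => ⟨fun f => ?_, fun g hg => ?_⟩⟩
    · rw [Functor.map_comp]
      exact mono_comp _ _
    · obtain ⟨f', hf'⟩ := Triangle.yoneda_exact₂ _ h f (hzero Y hY _ _ (by push_cast; lia) _)
      obtain ⟨g, rfl⟩ := (H Y hY).1 f'
      exact ⟨g, by rw [hf', Category.assoc]; rfl⟩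
    · refine (H Y hY).2 g ?_
      obtain ⟨g', hg'⟩ := Triangle.yoneda_exact₃ _ h (α ≫ g)
        ((Category.assoc q α g).symm.trans hg)
      let e := ((singleFunctors A).shiftIso 1 k (k + 1 : ℕ) (by push_cast; lia)).app
        (∐ fun _ : I => T)
      have : e.inv ≫ g' = 0 := hzero Y hY k (-1) (by lia) _
      have : g' = 0 := (cancel_epi e.inv).1 (this.trans comp_zero.symm)
      exact hg'.trans (by rw [this]; exact comp_zero)

/-- Special preenvelopes in the tilting class. -/
theorem exists_mono_tiltingClass (hT : IsTilting.{v} n T) (X : A) :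
    ∃ (Y : A) (a : X ⟶ Y), Mono a ∧ tiltingClass.{v} T Y ∧
      leftTiltingClass.{v} T (cokernel a) := by
  have hK : VanishesAbove T n ((singleFunctor A 0).obj X) := by
    refine ⟨fun j => inferInstance, fun j hj => ?_⟩
    have := hT.projectiveDimension_le
    have := HasProjectiveDimensionLT.subsingleton.{v} T (n + 1) j.toNat (by lia) X
    exact (singleHomEquivExt T X j 0 j.toNat (by lia)).subsingleton
  obtain ⟨K, α, hα, hGE, hK', H⟩ := exists_hom_vanishesAbove_zero hT n _ hK
  have := hK'.isLE hT
  -- Concentrated in degree 0 from both sides, `K` is an object of A.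
  obtain ⟨Y, ⟨e⟩⟩ := K.exists_iso_singleFunctor_obj_of_isGE_of_isLE 0
  obtain ⟨a, ha⟩ := (singleFunctor A 0).map_surjective (α ≫ e.hom)
  have ha' : Mono a := by
    refine mono_of_mono_homology_single a 0 ?_
    rw [ha, Functor.map_comp]
    exact mono_comp _ _
  have hY : tiltingClass.{v} T Y := fun i hi => by
    have := (hK'.of_iso e).2 i (by lia)
    exact (singleHomEquivExt T Y i 0 i (by lia)).symm.subsingleton
  refine ⟨Y, a, ha', hY, fun Z hZ => ?_⟩
  have hS := shortExact_cokernel a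
  suffices ∀ f : (singleFunctor A 0).obj (cokernel a) ⟶ (singleFunctor A (-1)).obj Z, f = 0 from
    have := subsingleton_of_forall_eq_zero this
    (singleHomEquivExt (cokernel a) Z 0 (-1) 1 (by lia)).symm.subsingleton
  intro f
  have h₁ : (singleFunctor A 0).map (cokernel.π a) ≫ f = 0 := by
    rw [← cancel_epi e.hom, comp_zero]
    refine (H Z hZ).2 _ ?_
    rw [← Category.assoc, ← ha, ← Functor.map_comp_assoc, cokernel.condition, Functor.map_zero,
      zero_comp]
  -- So f is the connecting morphism followed by a shifted morphism X → Z. The latter extends along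
  -- a, and the connecting morphism composed with the shift of a is zero.
  obtain ⟨g, hg⟩ := Triangle.yoneda_exact₃ _ hS.singleTriangle_distinguished f h₁
  let e' := ((singleFunctors A).shiftIso 1 (-1) 0 (by lia)).app Z
  obtain ⟨g', hg'⟩ := (shiftFunctor (DerivedCategory A) (1 : ℤ)).map_surjective (g ≫ e'.inv)
  obtain ⟨k, hk⟩ := (H Z hZ).1 g'
  have hk' : (singleFunctor A 0).map a ≫ e.inv ≫ k = g' := by rw [ha]; simpa using hk
  have h₂ : hS.singleTriangle.mor₃ ≫ ((singleFunctor A 0).map a)⟦(1 : ℤ)⟧' = 0 :=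
    comp_distTriang_mor_zero₃₁ _ hS.singleTriangle_distinguished
  refine (cancel_mono e'.inv).1 (Eq.trans ?_ zero_comp.symm)
  rw [hg]
  refine (Category.assoc _ _ _).trans ((congrArg (hS.singleTriangle.mor₃ ≫ ·) hg'.symm).trans ?_)
  refine (congrArg (hS.singleTriangle.mor₃ ≫ ·) ((congrArg _ hk'.symm).trans
    ((shiftFunctor (DerivedCategory A) (1 : ℤ)).map_comp _ _))).trans ?_
  exact (Category.assoc _ _ _).symm.trans ((congrArg (· ≫ _) h₂).trans zero_comp)

end TiltingApproximations

/-! ### Exactness of colimits and coproducts -/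

section ExactColimits

variable {A : Type u} [Category.{v} A] [Abelian A]

theorem shortExact_colim {J : Type*} [Category* J] [HasColimitsOfShape J A]
    [HasExactColimitsOfShape J A] {S : ShortComplex (J ⥤ A)} (hS : S.ShortExact) :
    (S.map colim).ShortExact :=
  hS.map_of_exact colim

theorem shortExact_eval {J : Type*} [Category* J] {S : ShortComplex (J ⥤ A)} (hS : S.ShortExact)
    (j : J) : (S.map ((evaluation J A).obj j)).ShortExact :=
  hS.map_of_exact _

theorem mono_sigma_map {I : Type*} [HasColimitsOfShape (Discrete I) A]
    [HasExactColimitsOfShape (Discrete I) A] {X Y : I → A} (f : ∀ i, X i ⟶ Y i)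
    [∀ i, Mono (f i)] : Mono (Limits.Sigma.map f) := by
  have : ∀ j : Discrete I, Mono ((Discrete.natTrans fun i => f i.as :
    Discrete.functor X ⟶ Discrete.functor Y).app j) := fun j => inferInstanceAs (Mono (f j.as))
  have := NatTrans.mono_of_mono_app (Discrete.natTrans fun i => f i.as :
    Discrete.functor X ⟶ Discrete.functor Y)
  exact inferInstanceAs (Mono (colim.map (Discrete.natTrans fun i => f i.as :
    Discrete.functor X ⟶ Discrete.functor Y)))

theorem shortExact_sigma {I : Type*} [HasColimitsOfShape (Discrete I) A]
    [HasExactColimitsOfShape (Discrete I) A] {X Y Z : I → A} (f : ∀ i, X i ⟶ Y i)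
    (g : ∀ i, Y i ⟶ Z i) (w : ∀ i, f i ≫ g i = 0)
    (h : ∀ i, (ShortComplex.mk (f i) (g i) (w i)).ShortExact) :
    (ShortComplex.mk (Limits.Sigma.map f) (Limits.Sigma.map g)
      (by ext i; simp [reassoc_of% w])).ShortExact := by
  have (i : I) : Mono (f i) := (h i).mono_f
  have (i : I) : Epi (g i) := (h i).epi_g
  have := mono_sigma_map f
  have : Epi (Limits.Sigma.map g) := inferInstance
  refine { exact := ShortComplex.exact_of_g_is_cokernel _ (CokernelCofork.IsColimit.ofπ _ _
    (fun {W} k hk => Sigma.desc fun i => (h i).gIsCokernel.desc (CokernelCofork.ofπ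
      (Sigma.ι Y i ≫ k) ?_)) (fun {W} k hk => ?_) fun {W} k hk l hl => ?_) }
  · have := Sigma.ι X i ≫= hk
    simpa using this
  · ext i
    simp
    exact (h i).gIsCokernel.fac (CokernelCofork.ofπ (Sigma.ι Y i ≫ k) _) WalkingParallelPair.one
  · rw [← cancel_epi (Limits.Sigma.map g), hl]
    ext i
    simp
    exact ((h i).gIsCokernel.fac (CokernelCofork.ofπ (Sigma.ι Y i ≫ k) _)
      WalkingParallelPair.one).symm

end ExactColimits

/-! ### More on Ext: dimension shifting and retracts -/

section ExtSequences

variable {A : Type u} [Category.{v} A] [Abelian A] [HasExt.{w} A] {S : ShortComplex A}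

open Abelian

theorem subsingleton_ext_contravariant₁ (hS : S.ShortExact) (Y : A) {i j : ℕ} (hij : i + 1 = j)
    (h₂ : Subsingleton (Ext.{w} S.X₂ Y i)) (h₃ : Subsingleton (Ext.{w} S.X₃ Y j)) :
    Subsingleton (Ext.{w} S.X₁ Y i) := by
  refine subsingleton_of_forall_eq_zero fun x => ?_
  obtain ⟨y, rfl⟩ := Ext.contravariant_sequence_exact₁ hS Y x (by lia : 1 + i = j) (h₃.elim _ _)
  rw [h₂.elim y 0, Ext.comp_zero]

theorem subsingleton_ext_of_retract_left {X X' : A} (r : Retract X' X) (Y : A) {i : ℕ}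
    (h : Subsingleton (Ext.{w} X Y i)) : Subsingleton (Ext.{w} X' Y i) := by
  refine subsingleton_of_forall_eq_zero fun x => ?_
  have : (Ext.mk₀ r.i).comp ((Ext.mk₀ r.r).comp x (zero_add i)) (zero_add i) = x := by
    rw [Ext.mk₀_comp_mk₀_assoc, r.retract, Ext.mk₀_id_comp]
  rw [← this, h.elim ((Ext.mk₀ r.r).comp x (zero_add i)) 0, Ext.comp_zero]

theorem subsingleton_ext_of_retract_right {Y Y' : A} (r : Retract Y' Y) (X : A) {i : ℕ}
    (h : Subsingleton (Ext.{w} X Y i)) : Subsingleton (Ext.{w} X Y' i) := by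
  refine subsingleton_of_forall_eq_zero fun x => ?_
  have : (x.comp (Ext.mk₀ r.i) (add_zero i)).comp (Ext.mk₀ r.r) (add_zero i) = x := by
    rw [Ext.comp_assoc_of_third_deg_zero, Ext.mk₀_comp_mk₀, r.retract, Ext.comp_mk₀_id]
  rw [← this, h.elim (x.comp (Ext.mk₀ r.i) (add_zero i)) 0, Ext.zero_comp]

end ExtSequences

/-! ### Closure properties of the two classes -/

section TiltingClasses

variable {A : Type u} [Category.{v} A] [Abelian A] [HasColimits A] [AB5 A] [HasExt.{v} A]
  [HasDerivedCategory.{w} A] {n : ℕ} {T : A}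

open DerivedCategory

theorem subsingleton_ext_sigma {I : Type v} (X : I → A) (Y : A) (i : ℕ)
    (h : ∀ k, Subsingleton (Abelian.Ext.{v} (X k) Y i)) :
    Subsingleton (Abelian.Ext.{v} (∐ X) Y i) := by
  have := hasExactColimitsOfShape_discrete (A := A) I
  suffices Subsingleton ((singleFunctor A i).obj (∐ X) ⟶ (singleFunctor A 0).obj Y) from
    (singleHomEquivExt (∐ X) Y i 0 i (by lia)).symm.subsingleton
  refine subsingleton_of_forall_eq_zero fun f => singleHom_sigma_eq_zero _ _ _ fun k => ?_
  have := h k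
  exact (singleHomEquivExt (X k) Y i 0 i (by lia)).subsingleton.elim _ _

/-- The objects `X` such that `Ext^i(T, X) = 0` for all `i > m`. -/
def vanishingClass {A : Type u} [Category.{v} A] [Abelian A] [HasExt.{v} A] (T : A) (m : ℕ) :
    ObjectProperty A :=
  fun X => ∀ i : ℕ, m < i → Subsingleton (Abelian.Ext.{v} T X i)

theorem vanishingClass_of_retract {A : Type u} [Category.{v} A] [Abelian A] [HasExt.{v} A] {T : A}
    {m : ℕ} {X X' : A} (h : vanishingClass T m X) (r : Retract X' X) : vanishingClass T m X' :=
  fun i hi => subsingleton_ext_of_retract_right r T (h i hi)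

theorem vanishingClass_X₃ {A : Type u} [Category.{v} A] [Abelian A] [HasExt.{v} A] {T : A} {m : ℕ}
    {S : ShortComplex A} (hS : S.ShortExact) (h₂ : vanishingClass T m S.X₂)
    (h₁ : vanishingClass T (m + 1) S.X₁) : vanishingClass T m S.X₃ :=
  fun i hi => subsingleton_ext_covariant₃ hS T rfl (h₂ i hi) (h₁ (i + 1) (by lia))

theorem vanishingClass_X₁ {A : Type u} [Category.{v} A] [Abelian A] [HasExt.{v} A] {T : A} {m : ℕ}
    {S : ShortComplex A} (hS : S.ShortExact) (h₂ : vanishingClass T (m + 1) S.X₂)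
    (h₃ : vanishingClass T m S.X₃) : vanishingClass T (m + 1) S.X₁ := fun i hi => by
  obtain ⟨j, rfl⟩ : ∃ j, i = j + 1 := ⟨i - 1, by lia⟩
  exact subsingleton_ext_covariant₁ hS T rfl (h₃ j (by lia)) (h₂ _ hi)

theorem vanishingClass_mono {A : Type u} [Category.{v} A] [Abelian A] [HasExt.{v} A] (T : A)
    {m m' : ℕ} (h : m ≤ m') : vanishingClass T m ≤ vanishingClass T m' :=
  fun _ hX i hi => hX i (by lia)

theorem IsTilting.vanishingClass_eq_top {A : Type u} [Category.{v} A] [Abelian A]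
    [HasCoproducts.{v} A] [HasExt.{v} A] [HasDerivedCategory.{w} A] {n : ℕ} {T : A}
    (hT : IsTilting.{v} n T) (X : A) :
    vanishingClass T n X := fun i hi => by
  have := hT.projectiveDimension_le
  exact HasProjectiveDimensionLT.subsingleton.{v} T (n + 1) i (by lia) X

/-- The tilting class is closed under coproducts. -/
theorem tiltingClass_sigma (hT : IsTilting.{v} n T) {I : Type v} (X : I → A)
    (hX : ∀ i, tiltingClass.{v} T (X i)) : tiltingClass.{v} T (∐ X) := by
  have := hasExactColimitsOfShape_discrete (A := A) I
  -- Descending induction on m, with k bounding n - m: for m ≥ n all objects qualify, and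
  -- presentations by coproducts of T shift the degree.
  suffices ∀ k m : ℕ, n ≤ m + k → ∀ X : I → A, (∀ i, tiltingClass.{v} T (X i)) →
      vanishingClass T m (∐ X) from this n 0 (by lia) X hX
  intro k
  induction k with
  | zero => exact fun m hm X hX => vanishingClass_mono T hm _ (hT.vanishingClass_eq_top _)
  | succ k ih =>
    intro m hm X hX
    choose B π hπ hN using fun i => exists_epi_of_tiltingClass hT (hX i)
    have hS := shortExact_sigma (fun i => kernel.ι (π i)) π (by simp) fun i =>
      shortExact_kernel (π i)
    refine vanishingClass_X₃ hS ?_ (ih (m + 1) (by lia) _ hN)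
    let e := sigmaSigmaIso (fun i => B i) (fun _ _ => T)
    exact fun i hi => subsingleton_ext_of_retract_right
      (Retract.ofIso e) T (hT.ext_coproduct _ i (by lia))

/-- Special preenvelopes lower the bound on the cokernels, and coproducts of the preenvelopes stay
in E. -/
theorem vanishingClass_sigma (hT : IsTilting.{v} n T) {I : Type v} (m : ℕ) (X : I → A)
    (hX : ∀ i, vanishingClass T m (X i)) : vanishingClass T m (∐ X) := by
  have := hasExactColimitsOfShape_discrete (A := A) I
  induction m generalizing X with
  | zero => exact tiltingClass_sigma hT X hX
  | succ m ih =>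
    choose Y a ha hY ha' using fun i => exists_mono_tiltingClass hT (X i)
    have hS := shortExact_sigma a (fun i => cokernel.π (a i)) (by simp) fun i =>
      shortExact_cokernel (a i)
    exact vanishingClass_X₁ hS
      (vanishingClass_mono T (Nat.zero_le _) _ (tiltingClass_sigma hT Y hY))
      (ih _ fun i => vanishingClass_X₃ (shortExact_cokernel (a i))
        (vanishingClass_mono T (Nat.zero_le _) _ (hY i)) (hX i))

/-- The right class of the cotorsion pair is also orthogonal to the left class in higher
degrees. -/
theorem subsingleton_ext_leftTiltingClass (hT : IsTilting.{v} n T) {X Y : A}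
    (hX : leftTiltingClass.{v} T X) (hY : tiltingClass.{v} T Y) {i : ℕ} (hi : 0 < i) :
    Subsingleton (Abelian.Ext.{v} X Y i) := by
  -- An object of L ∩ E is a retract of a coproduct of copies of T, since its presentation has
  -- kernel in E and splits.
  have h₀ (X : A) (hX : leftTiltingClass.{v} T X) (hX' : tiltingClass.{v} T X) (i : ℕ)
      (hi : 0 < i) : Subsingleton (Abelian.Ext.{v} X Y i) := by
    obtain ⟨I, π, hπ, hN⟩ := exists_epi_of_tiltingClass hT hX'
    obtain ⟨s, hs⟩ := surjective_hom_of_subsingleton_ext (shortExact_kernel π) X (hX _ hN) (𝟙 X)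
    exact subsingleton_ext_of_retract_left ⟨s, π, hs⟩ Y
      (subsingleton_ext_sigma _ Y i fun _ => hY i hi)
  suffices ∀ m X, leftTiltingClass.{v} T X → vanishingClass T m X → ∀ i, 0 < i →
      Subsingleton (Abelian.Ext.{v} X Y i) from this n X hX (hT.vanishingClass_eq_top X) i hi
  intro m
  induction m with
  | zero => exact h₀
  | succ m ih =>
    intro X hX hX' i hi
    -- Z lies in L ∩ E as an extension of objects of L, and the cokernel has a smaller bound.
    obtain ⟨Z, a, ha, hZ, hC⟩ := exists_mono_tiltingClass hT X
    have hS := shortExact_cokernel a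
    exact subsingleton_ext_contravariant₁ hS Y rfl
      (h₀ Z (fun W hW => subsingleton_ext_contravariant₂ hS W (hX W hW) (hC W hW)) hZ i hi)
      (ih _ hC (vanishingClass_X₃ hS (vanishingClass_mono T (Nat.zero_le _) _ hZ) hX') _ (by lia))

theorem leftTiltingClass_of_retract {A : Type u} [Category.{v} A] [Abelian A] [HasExt.{v} A]
    {T : A} {X X' : A} (h : leftTiltingClass.{v} T X) (r : Retract X' X) :
    leftTiltingClass.{v} T X' :=
  fun Y hY => subsingleton_ext_of_retract_left r Y (h Y hY)

theorem leftTiltingClass_sigma {I : Type v} (X : I → A)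
    (hX : ∀ i, leftTiltingClass.{v} T (X i)) : leftTiltingClass.{v} T (∐ X) :=
  fun Y hY => subsingleton_ext_sigma X Y 1 fun i => hX i Y hY

theorem leftTiltingClass_X₂ {A : Type u} [Category.{v} A] [Abelian A] [HasExt.{v} A]
    {T : A} {S : ShortComplex A} (hS : S.ShortExact) (h₁ : leftTiltingClass.{v} T S.X₁)
    (h₃ : leftTiltingClass.{v} T S.X₃) : leftTiltingClass.{v} T S.X₂ :=
  fun Y hY => subsingleton_ext_contravariant₂ hS Y (h₁ Y hY) (h₃ Y hY)

/-- The obstruction lies in Ext^2 of the quotient, which vanishes by the higher orthogonality. -/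
theorem leftTiltingClass_X₁ (hT : IsTilting.{v} n T) {S : ShortComplex A} (hS : S.ShortExact)
    (h₂ : leftTiltingClass.{v} T S.X₂) (h₃ : leftTiltingClass.{v} T S.X₃) :
    leftTiltingClass.{v} T S.X₁ :=
  fun Y hY => subsingleton_ext_contravariant₁ hS Y rfl (h₂ Y hY)
    (subsingleton_ext_leftTiltingClass hT h₃ hY (by lia))

end TiltingClasses

/-! ### Initial coproducts and the absorbing endomorphisms -/

section InitialCoproducts

variable {A : Type u} [Category.{v} A] [HasColimits A] {I : Type v} [PartialOrder I]

/-- The functor sending `j` to the coproduct of the objects `X i` for `i ≤ j`. -/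
noncomputable def initialCoproduct (X : I → A) : I ⥤ A where
  obj j := ∐ fun i : Set.Iic j => X i
  map {j k} f := Sigma.desc fun i =>
    Sigma.ι (fun i : Set.Iic k => X i) ⟨i.1, i.2.trans (leOfHom f)⟩

namespace initialCoproduct

/-- The inclusion of a member of the family in an initial coproduct. -/
noncomputable def incl (X : I → A) {i j : I} (h : i ≤ j) : X i ⟶ (initialCoproduct X).obj j :=
  Sigma.ι (fun i : Set.Iic j => X i) ⟨i, h⟩

/-- The morphism from an initial coproduct induced by a family of morphisms. -/
noncomputable def desc {X : I → A} {j : I} {W : A} (f : ∀ i, i ≤ j → (X i ⟶ W)) :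
    (initialCoproduct X).obj j ⟶ W :=
  Sigma.desc fun i : Set.Iic j => f i.1 i.2

@[simp]
theorem incl_desc {X : I → A} {i j : I} {W : A} (f : ∀ i, i ≤ j → (X i ⟶ W)) (h : i ≤ j) :
    incl X h ≫ desc f = f i h :=
  Sigma.ι_desc _ _

@[simp]
theorem incl_desc_assoc {X : I → A} {i j : I} {W W' : A} (f : ∀ i, i ≤ j → (X i ⟶ W))
    (h : i ≤ j) (g : W ⟶ W') : incl X h ≫ desc f ≫ g = f i h ≫ g := by
  rw [← Category.assoc, incl_desc]

theorem hom_ext {X : I → A} {j : I} {W : A} {f g : (initialCoproduct X).obj j ⟶ W}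
    (h : ∀ i (hi : i ≤ j), incl X hi ≫ f = incl X hi ≫ g) : f = g :=
  Sigma.hom_ext _ _ fun i => h i.1 i.2

@[simp]
theorem incl_map (X : I → A) {i j k : I} (h : i ≤ j) (f : j ⟶ k) :
    incl X h ≫ (initialCoproduct X).map f = incl X (h.trans (leOfHom f)) :=
  Sigma.ι_desc _ _

@[simp]
theorem incl_map_assoc (X : I → A) {i j k : I} (h : i ≤ j) (f : j ⟶ k) {W : A}
    (g : (initialCoproduct X).obj k ⟶ W) :
    incl X h ≫ (initialCoproduct X).map f ≫ g = incl X (h.trans (leOfHom f)) ≫ g := by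
  rw [← Category.assoc, incl_map]

/-- The morphism of functors induced by a family of morphisms. -/
noncomputable def natMap {X Y : I → A} (f : ∀ i, X i ⟶ Y i) :
    initialCoproduct X ⟶ initialCoproduct Y where
  app j := desc fun i h => f i ≫ incl Y h
  naturality j k g := hom_ext fun i h => by simp

theorem natMap_app {X Y : I → A} (f : ∀ i, X i ⟶ Y i) (j : I) :
    (natMap f).app j = Limits.Sigma.map fun i : Set.Iic j => f i :=
  hom_ext fun i hi => (incl_desc (fun k hk => f k ≫ incl Y hk) hi).trans
    (Sigma.ι_map (fun i : Set.Iic j => f i) ⟨i, hi⟩).symm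

/-- The inclusion of a member of a family in the colimit of the initial coproducts. -/
noncomputable def toColimit (X : I → A) (i : I) : X i ⟶ colimit (initialCoproduct X) :=
  incl X le_rfl ≫ colimit.ι (initialCoproduct X) i

theorem incl_ι (X : I → A) {i j : I} (h : i ≤ j) :
    incl X h ≫ colimit.ι (initialCoproduct X) j = toColimit X i := by
  rw [toColimit, ← colimit.w (initialCoproduct X) (homOfLE h), incl_map_assoc]

theorem colimit_hom_ext {X : I → A} {W : A} {f g : colimit (initialCoproduct X) ⟶ W}
    (h : ∀ i, toColimit X i ≫ f = toColimit X i ≫ g) : f = g :=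
  colimit.hom_ext fun j => hom_ext fun i hi => by
    rw [← Category.assoc, ← Category.assoc, incl_ι, h]

/-- The morphism from the colimit of the initial coproducts given by a family of morphisms. -/
noncomputable def colimitDesc {X : I → A} {W : A} (f : ∀ i, X i ⟶ W) :
    colimit (initialCoproduct X) ⟶ W :=
  colimit.desc _ (Cocone.mk W
    { app j := desc fun i _ => f i
      naturality j k g := hom_ext fun i hi => by simp })

@[simp]
theorem toColimit_desc {X : I → A} {W : A} (f : ∀ i, X i ⟶ W) (i : I) :
    toColimit X i ≫ colimitDesc f = f i := by
  simp [toColimit, colimitDesc]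

@[simp]
theorem toColimit_desc_assoc {X : I → A} {W W' : A} (f : ∀ i, X i ⟶ W) (i : I) (g : W ⟶ W') :
    toColimit X i ≫ colimitDesc f ≫ g = f i ≫ g := by
  rw [← Category.assoc, toColimit_desc]

/-- The colimit of the initial coproducts is the coproduct. -/
noncomputable def colimitIso (X : I → A) : colimit (initialCoproduct X) ≅ ∐ X where
  hom := colimitDesc (Sigma.ι X)
  inv := Sigma.desc (toColimit X)
  hom_inv_id := colimit_hom_ext fun i => by simp
  inv_hom_id := Sigma.hom_ext _ _ fun i => by simp

variable (F : I ⥤ A)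

/-- The canonical morphism from the initial coproducts of the terms of a diagram. -/
noncomputable def augmentation : initialCoproduct F.obj ⟶ F where
  app j := desc fun i h => F.map (homOfLE h)
  naturality j k g := hom_ext fun i h => by
    rw [incl_map_assoc, incl_desc, incl_desc_assoc, ← F.map_comp]
    rfl

theorem incl_augmentation_app {i j : I} (h : i ≤ j) :
    incl F.obj h ≫ (augmentation F).app j = F.map (homOfLE h) :=
  incl_desc (X := F.obj) (fun _ h => F.map (homOfLE h)) h

theorem incl_refl_augmentation_app (j : I) :
    incl F.obj (le_refl j) ≫ (augmentation F).app j = 𝟙 (F.obj j) :=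
  (incl_augmentation_app F _).trans (F.map_id j)

instance : Epi (augmentation F) := by
  have (j : I) : Epi ((augmentation F).app j) := by
    have : Epi (incl F.obj (le_refl j) ≫ (augmentation F).app j) := by
      rw [incl_refl_augmentation_app]
      infer_instance
    exact epi_of_epi (incl F.obj (le_refl j)) _
  exact NatTrans.epi_of_epi_app _

@[simp]
theorem toColimit_colimMap (i : I) :
    toColimit F.obj i ≫ colimMap (augmentation F) = colimit.ι F i := by
  rw [toColimit, Category.assoc, ι_colimMap, ← Category.assoc, incl_refl_augmentation_app,
    Category.id_comp]

/-- The endomorphism of the coproduct of the terms of a diagram which replaces the terms of index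
at most `j` by their images in the term of index `j`. -/
noncomputable def absorb (j : I) :
    colimit (initialCoproduct F.obj) ⟶ colimit (initialCoproduct F.obj) :=
  open Classical in
  colimitDesc fun i =>
    if h : i ≤ j then F.map (homOfLE h) ≫ toColimit F.obj j else toColimit F.obj i

/-- Since it factors through the augmentation at j, absorption kills the relations of stage j. -/
theorem ι_absorb (j : I) : colimit.ι (initialCoproduct F.obj) j ≫ absorb F j =
    (augmentation F).app j ≫ toColimit F.obj j :=
  hom_ext fun i h => by
    rw [← Category.assoc, incl_ι, absorb, toColimit_desc, dif_pos h, ← Category.assoc,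
      incl_augmentation_app]

/-- A term and its image in a later term agree in the colimit. Being over the colimit makes
absorption usable with the cover property. -/
theorem absorb_colimMap (j : I) :
    absorb F j ≫ colimMap (augmentation F) = colimMap (augmentation F) :=
  colimit_hom_ext fun i => by
    rw [absorb, toColimit_desc_assoc]
    split_ifs <;> simp

end initialCoproduct

end InitialCoproducts

/-! ### Relations of a diagram -/

section Relations

variable {A : Type u} [Category.{v} A] [Abelian A] [HasColimits A] {I : Type v} [PartialOrder I]

open initialCoproduct

theorem shortExact_relations (F : I ⥤ A) :
    (ShortComplex.mk (kernel.ι (augmentation F)) (augmentation F)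
      (kernel.condition _)).ShortExact :=
  shortExact_kernel _

/-- The relations are pointwise a retract of the initial coproducts. -/
noncomputable def retractRelations (F : I ⥤ A) (j : I) :
    Retract ((kernel (augmentation F)).obj j) (∐ fun i : Set.Iic j => F.obj i) :=
  have hS := shortExact_eval (shortExact_relations F) j
  -- The summand of index j splits the augmentation at j, but not naturally in j.
  have σ := ShortComplex.Splitting.ofExactOfSection _ hS.exact
    (incl F.obj (le_refl j)) (incl_refl_augmentation_app F j) hS.mono_f
  { i := _, r := σ.r, retract := σ.f_r }

theorem initialCoproduct.mono_natMap [AB5 A] {X Y : I → A} (f : ∀ i, X i ⟶ Y i)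
    [∀ i, Mono (f i)] : Mono (natMap f) := by
  have (j : I) : Mono ((natMap f).app j) := by
    have := hasExactColimitsOfShape_discrete (A := A) (Set.Iic j)
    rw [natMap_app]
    exact mono_sigma_map fun i : Set.Iic j => f i
  exact NatTrans.mono_of_mono_app _

/-- The cokernel of a morphism of initial coproducts is pointwise a coproduct of cokernels. -/
theorem initialCoproduct.nonempty_iso_cokernel_natMap [AB5 A] {X Y : I → A}
    (f : ∀ i, X i ⟶ Y i) [∀ i, Mono (f i)] (j : I) :
    Nonempty ((cokernel (natMap f)).obj j ≅ ∐ fun i : Set.Iic j => cokernel (f i)) := by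
  have := mono_natMap f
  have := hasExactColimitsOfShape_discrete (A := A) (Set.Iic j)
  have h₁ := shortExact_eval (shortExact_cokernel (natMap f)) j
  have h₂ := shortExact_sigma (fun i : Set.Iic j => f i) (fun i => cokernel.π (f i)) (by simp)
    fun i => shortExact_cokernel (f i)
  exact ⟨h₁.gIsCokernel.coconePointUniqueUpToIso (cokernelIsCokernel ((natMap f).app j)) ≪≫
    cokernelIsoOfEq (natMap_app f j) ≪≫
    (cokernelIsCokernel _).coconePointUniqueUpToIso h₂.gIsCokernel⟩

end Relations

/-! ### Direct limits in the tilting class and in L ∩ E -/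

section DirectLimits

open initialCoproduct

variable {A : Type u} [Category.{v} A] [Abelian A] [HasColimits A] [AB5 A] [HasExt.{v} A]
  [HasDerivedCategory.{w} A] {n : ℕ} {T : A} {I : Type v} [PartialOrder I] [IsDirectedOrder I]
  [Nonempty I]

/-- The tilting class is closed under direct limits. -/
theorem tiltingClass_colimit (hT : IsTilting.{v} n T) (F : I ⥤ A)
    (hF : ∀ i, tiltingClass.{v} T (F.obj i)) : tiltingClass.{v} T (colimit F) := by
  suffices ∀ k m : ℕ, n ≤ m + k → ∀ F : I ⥤ A, (∀ i, tiltingClass.{v} T (F.obj i)) →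
      vanishingClass T m (colimit F) from this n 0 (by lia) F hF
  intro k
  induction k with
  | zero => exact fun m hm X hX => vanishingClass_mono T hm _ (hT.vanishingClass_eq_top _)
  | succ k ih =>
    intro m hm F hF
    refine vanishingClass_X₃ (shortExact_colim (shortExact_relations F)) ?_
      (ih (m + 1) (by lia) _ fun i => ?_)
    · exact vanishingClass_of_retract (vanishingClass_mono T (Nat.zero_le _) _
        (tiltingClass_sigma hT _ hF)) (Retract.ofIso (colimitIso F.obj))
    · exact vanishingClass_of_retract (m := 0)
        (tiltingClass_sigma hT (fun k : Set.Iic i => F.obj k) fun k => hF k.1)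
        (retractRelations F i)

/-- If `L`-covers exist, direct limits of objects in the kernel of the cotorsion pair are in
`L`. -/
theorem leftTiltingClass_colimit_of_tiltingClass (hT : IsTilting.{v} n T)
    (hcover : ∀ X : A, ∃ (Y : A) (l : Y ⟶ X), IsCover (leftTiltingClass.{v} T) l) (F : I ⥤ A)
    (hF : ∀ i, leftTiltingClass.{v} T (F.obj i)) (hF' : ∀ i, tiltingClass.{v} T (F.obj i)) :
    leftTiltingClass.{v} T (colimit F) := by
  have hS := shortExact_colim (shortExact_relations F)
  have hK : tiltingClass.{v} T (colimit (kernel (augmentation F))) :=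
    tiltingClass_colimit hT _ fun i => vanishingClass_of_retract (m := 0)
      (tiltingClass_sigma hT (fun k : Set.Iic i => F.obj k) fun k => hF' k.1) (retractRelations F i)
  have hP : leftTiltingClass.{v} T (colimit (initialCoproduct F.obj)) :=
    leftTiltingClass_of_retract (leftTiltingClass_sigma _ hF)
      (Retract.ofIso (colimitIso F.obj))
  let p : colimit (initialCoproduct F.obj) ⟶ colimit F := colimMap (augmentation F)
  have hp : Epi p := hS.epi_g
  obtain ⟨Y, l, ⟨hY, hl⟩, hl'⟩ := hcover (colimit F)
  -- The kernel of p is in E and Y is in L, so the lifting obstruction vanishes.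
  obtain ⟨s, hs⟩ : ∃ s, s ≫ p = l := surjective_hom_of_subsingleton_ext hS Y (hY _ hK) l
  obtain ⟨q, hq⟩ := hl p hP
  let γ : kernel (augmentation F) ⟶
      (Functor.const I).obj (colimit (initialCoproduct F.obj)) :=
    kernel.ι (augmentation F) ≫ (colimit.cocone (initialCoproduct F.obj)).ι
  -- With P the coproduct and K_j the relations of stage j, `c` is Y → P → P/K_j, natural in j.
  let c := (Functor.const I).map s ≫ cokernel.π γ
  have hψ (j : I) : γ.app j ≫ absorb F j = 0 := by
    have : (kernel.ι (augmentation F)).app j ≫ (augmentation F).app j = 0 := by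
      rw [← NatTrans.comp_app, kernel.condition, NatTrans.app_zero]
    dsimp [γ]
    rw [Category.assoc, ι_absorb, reassoc_of% this, zero_comp]
  have hc (j : I) : Mono (c.app j) := by
    have hcok := (ShortComplex.exact_of_g_is_cokernel
      (ShortComplex.mk γ (cokernel.π γ) (cokernel.condition γ))
      (cokernelIsCokernel γ)).map ((evaluation I A).obj j)
    have : Epi ((cokernel.π γ).app j) := inferInstance
    have hepi : Epi ((ShortComplex.mk γ (cokernel.π γ) (cokernel.condition γ)).map
      ((evaluation I A).obj j)).g := this
    obtain ⟨θ, hθ⟩ : ∃ θ, (cokernel.π γ).app j ≫ θ = absorb F j :=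
      ⟨_, hcok.g_desc _ (hψ j)⟩
    -- This endomorphism of Y lies over l because absorption lies over colim F.
    have : IsIso (c.app j ≫ θ ≫ q) := by
      refine hl' _ ?_
      dsimp [c]
      simp only [Category.assoc, hq]
      rw [reassoc_of% hθ, absorb_colimMap]
      exact hs
    exact mono_of_mono (c.app j) (θ ≫ q)
  have := NatTrans.mono_of_mono_app c
  have hc' : Mono (colim.map c) := inferInstance
  obtain ⟨j₀⟩ : Nonempty I := inferInstance
  let x : colimit (initialCoproduct F.obj) ⟶ colimit (cokernel γ) :=
    (cokernel.π γ).app j₀ ≫ colimit.ι (cokernel γ) j₀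
  have hx (j : I) : x = (cokernel.π γ).app j ≫ colimit.ι (cokernel γ) j := by
    obtain ⟨k, hk, hk₀⟩ := exists_ge_ge j j₀
    have (i : I) (hi : i ≤ k) : (cokernel.π γ).app i ≫ colimit.ι (cokernel γ) i =
        (cokernel.π γ).app k ≫ colimit.ι (cokernel γ) k := by
      rw [← colimit.w (cokernel γ) (homOfLE hi), ← NatTrans.naturality_assoc]
      simp
    rw [this j hk, ← this j₀ hk₀]
  have := hS.epi_g
  -- P → colim P/K_j kills every K_j, so it factors through colim F. Thus `l ≫ y = s ≫ x` is Y
  -- followed by the mono `colim.map c`, which forces l to be mono.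
  obtain ⟨y, hy⟩ : ∃ y, p ≫ y = x := by
    refine ⟨_, hS.exact.g_desc (x : colimit (initialCoproduct F.obj) ⟶ colimit (cokernel γ)) ?_⟩
    refine colimit.hom_ext fun j => ?_
    have : γ.app j ≫ (cokernel.π γ).app j = 0 := by
      rw [← NatTrans.comp_app, cokernel.condition, NatTrans.app_zero]
    have h₁ : colimit.ι (kernel (augmentation F)) j ≫ colimMap (kernel.ι (augmentation F)) =
        γ.app j := ι_colimMap _ _
    refine (Category.assoc _ _ _).symm.trans (Eq.trans ?_ comp_zero.symm)
    refine (congrArg (· ≫ x) h₁).trans ?_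
    rw [hx j]
    refine (Category.assoc _ _ _).symm.trans ?_
    rw [this, zero_comp]
  have hmono : Mono l := by
    refine Preadditive.mono_of_cancel_zero _ fun {Z} z hz => ?_
    have h₀ : colimit.ι ((Functor.const I).obj Y) j₀ ≫
        colimit.desc _ (Cocone.mk Y (𝟙 ((Functor.const I).obj Y))) = 𝟙 Y := by simp
    have h₁ : (z ≫ colimit.ι ((Functor.const I).obj Y) j₀) ≫ colim.map c = 0 := by
      have : colimit.ι ((Functor.const I).obj Y) j₀ ≫ colim.map c = s ≫ x := by
        simp [c, x]
      rw [Category.assoc, this, ← hy, ← Category.assoc s, hs, reassoc_of% hz, zero_comp]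
    have h₂ := (Preadditive.mono_iff_cancel_zero _).1 hc' _ _ h₁
    rw [← Category.comp_id z, ← h₀, reassoc_of% h₂, zero_comp]
  have hepi : Epi l := by
    rw [← hq] at hp
    exact epi_of_epi q l
  have := isIso_of_mono_of_epi l
  exact leftTiltingClass_of_retract hY (Retract.ofIso (asIso l).symm)

end DirectLimits

/-! ### Reduction to L ∩ E -/

section Main

variable {A : Type u} [Category.{v} A] [Abelian A] [HasColimits A] [AB5 A] [HasExt.{v} A]
  [HasDerivedCategory.{w} A] {n : ℕ} {T : A} {I : Type v} [PartialOrder I]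

open initialCoproduct

theorem shortExact_of_isPushout {C : Type*} [Category* C] [Abelian C] {X₁ X₂ X₃ X₄ : C}
    {t : X₁ ⟶ X₂} {l : X₁ ⟶ X₃} {r : X₂ ⟶ X₄} {b : X₃ ⟶ X₄} (sq : IsPushout t l r b) [Epi t]
    [Mono l] :
    Mono r ∧ Epi b ∧ Nonempty (kernel t ≅ kernel b) ∧ Nonempty (cokernel l ≅ cokernel r) := by
  have h₁ : Mono r := Abelian.mono_inl_of_isColimit _ _ sq.isColimit
  have h₂ := Abelian.epi_kernel_map_of_isPushout sq
  have h₃ : Mono (kernel.map _ _ _ _ sq.w) := by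
    have : Mono (kernel.map _ _ _ _ sq.w ≫ kernel.ι b) := by
      rw [kernel.lift_ι]
      exact mono_comp _ _
    exact mono_of_mono _ (kernel.ι b)
  have h₄ := isIso_of_mono_of_epi (kernel.map _ _ _ _ sq.w)
  have h₅ := isIso_cokernel_map_of_isPushout sq.flip
  exact ⟨h₁, (MorphismProperty.epimorphisms C).of_isPushout sq.flip (.infer_property t),
    ⟨asIso (kernel.map _ _ _ _ sq.w)⟩, ⟨asIso (cokernel.map _ _ _ _ sq.flip.w)⟩⟩

/-- A diagram of objects of `L` embeds in a diagram of objects of `L` that is closer to the tilting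
class, and so is the quotient. -/
theorem exists_shortExact_functor (hT : IsTilting.{v} n T) (m : ℕ) (F : I ⥤ A)
    (hF : ∀ i, leftTiltingClass.{v} T (F.obj i)) (hF' : ∀ i, vanishingClass T (m + 1) (F.obj i)) :
    ∃ (G : I ⥤ A) (a : F ⟶ G), Mono a ∧
      ∀ i, (leftTiltingClass.{v} T (G.obj i) ∧ vanishingClass T m (G.obj i)) ∧
        leftTiltingClass.{v} T ((cokernel a).obj i) ∧ vanishingClass T m ((cokernel a).obj i) := by
  -- Preenvelopes are not functorial in i. Initial coproducts turn them into a morphism of diagrams,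
  -- and pushing out along the augmentation embeds `F` itself.
  choose Y a ha hY hC using fun i => exists_mono_tiltingClass hT (F.obj i)
  have := mono_natMap a
  obtain ⟨h₁, h₂, ⟨e₁⟩, ⟨e₂⟩⟩ :=
    shortExact_of_isPushout (IsPushout.of_hasPushout (augmentation F) (natMap a))
  refine ⟨_, pushout.inl (augmentation F) (natMap a), h₁, fun i => ?_⟩
  have hS₁ := shortExact_eval (shortExact_cokernel (pushout.inl (augmentation F) (natMap a))) i
  have hS₂ := shortExact_eval (shortExact_kernel (pushout.inr (augmentation F) (natMap a))) i
  -- The pushout is a quotient of coproducts in E by the relations of `F`, whose bound m + 1 drops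
  -- by one.
  have hG : vanishingClass T m ((pushout (augmentation F) (natMap a)).obj i) := by
    refine vanishingClass_X₃ hS₂ (vanishingClass_mono T (Nat.zero_le _) _
      (tiltingClass_sigma hT (fun k : Set.Iic i => Y k) fun k => hY k.1)) ?_
    exact vanishingClass_of_retract (vanishingClass_of_retract
      (vanishingClass_sigma hT (m + 1) (fun k : Set.Iic i => F.obj k) fun k => hF' k.1)
      (retractRelations F i)) (Retract.ofIso (e₁.symm.app i))
  obtain ⟨e₃⟩ := nonempty_iso_cokernel_natMap a i
  have hH : leftTiltingClass.{v} T
      ((cokernel (pushout.inl (augmentation F) (natMap a))).obj i) :=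
    leftTiltingClass_of_retract (leftTiltingClass_sigma (fun k : Set.Iic i => cokernel (a k))
      fun k => hC k.1) (Retract.ofIso (e₂.symm.app i ≪≫ e₃))
  exact ⟨⟨leftTiltingClass_X₂ hS₁ (hF i) hH, hG⟩, hH, vanishingClass_X₃ hS₁ hG (hF' i)⟩

/-- Induction on the bound m: direct limits keep the embedding sequence exact, and L is closed under
kernels of epimorphisms between its objects. -/
theorem leftTiltingClass_colimit [IsDirectedOrder I] [Nonempty I] (hT : IsTilting.{v} n T)
    (hcover : ∀ X : A, ∃ (Y : A) (l : Y ⟶ X), IsCover (leftTiltingClass.{v} T) l) (m : ℕ)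
    (F : I ⥤ A) (hF : ∀ i, leftTiltingClass.{v} T (F.obj i))
    (hF' : ∀ i, vanishingClass T m (F.obj i)) : leftTiltingClass.{v} T (colimit F) := by
  induction m generalizing F with
  | zero => exact leftTiltingClass_colimit_of_tiltingClass hT hcover F hF hF'
  | succ m ih =>
    obtain ⟨G, a, ha, h⟩ := exists_shortExact_functor hT m F hF hF'
    exact leftTiltingClass_X₁ hT (shortExact_colim (shortExact_cokernel a))
      (ih G (fun i => (h i).1.1) fun i => (h i).1.2)
      (ih (cokernel a) (fun i => (h i).2.1) fun i => (h i).2.2)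

end Main

end TiltingEnochs

theorem mainTheorem6 {A : Type u} [CategoryTheory.Category.{v} A]
    [CategoryTheory.Abelian A] [CategoryTheory.Limits.HasColimits A]
    [CategoryTheory.AB5 A] [CategoryTheory.HasExt.{v} A] [HasDerivedCategory.{w} A]
    (n : ℕ) (T : A) (hT : TiltingEnochs.IsTilting.{v} n T)
    (hcover : ∀ X : A, ∃ (Y : A) (l : Y ⟶ X),
      TiltingEnochs.IsCover (TiltingEnochs.leftTiltingClass.{v} T) l) :
    TiltingEnochs.ClosedUnderDirectLimits (TiltingEnochs.leftTiltingClass.{v} T) := by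
  intro I _ _ _
  refine ⟨fun X ⟨p⟩ => ?_⟩
  exact TiltingEnochs.leftTiltingClass_of_retract
    (TiltingEnochs.leftTiltingClass_colimit hT hcover n p.diag p.prop_diag_obj
      fun i => hT.vanishingClass_eq_top _)
    (.ofIso (p.isColimit.coconePointUniqueUpToIso (CategoryTheory.Limits.colimit.isColimit _)))
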